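/- For $\overline d>\underline d\ge 0$ and $m,K>0$, let $\mathcal F^{\underline d,\overline d}_{m,K}$ be the set of cdfs $F$ on $\mathbb R$ that are differentiable on $[\underline d,\overline d]$ (one-sidedly at the endpoints) and satisfy $F(\underline d)=0$, $F'(d)\ge m$ for all $d\in[\underline d,\overline d]$, and $|F'(d)-F'(d_1)|\le K|d-d_1|$ for all $d,d_1\in[\underline d,\overline d]$. Let $D_1,\dots,D_G$ be i.i.d. with cdf $F$, with order statistics $D_{(1)}\le\dots\le D_{(G)}$, and let $P_F$ denote the corresponding probability. For $\alpha\in(0,1)$ let $T=D_{(1)}/(D_{(2)}-D_{(1)})$ (with $T:=0$ if $D_{(1)}=D_{(2)}$) and let $W_\alpha=\{T>1/\alpha-1\}$ be the critical region of the test. Theorem. Fix $\alpha\in(0,1)$, $\overline d>\underline d>0$, $m>0$ and $K>0$. 1. (Asymptotic size control) If $\mathcal F^{0,\overline d}_{m,K}\neq\emptyset$, then $\limsup_{G\to\infty}\sup_{F\in\mathcal F^{0,\overline d}_{m,K}}P_F(W_\alpha)=\alpha$. 2. (Uniform consistency) If $\mathcal F^{\underline d,\overline d}_{m,K}\neq\emptyset$,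 then $\liminf_{G\to\infty}\inf_{F\in\mathcal F^{\underline d,\overline d}_{m,K}}P_F(W_\alpha)=1$. 3. (Local power) For every sequence $(\underline d_G)_{G\ge1}$ in $[0,\overline d)$ such that $\liminf_{G\to\infty}G\,\underline d_G>0$ and $G(\overline d-\underline d_G)\to\infty$ (the latter holds in particular if $\limsup_{G\to\infty}\underline d_G<\overline d$, for instance if $\underline d_G\to0$), $\liminf_{G\to\infty}\inf_{F\in\mathcal F^{\underline d_G,\overline d}_{m,K}}P_F(W_\alpha)>\alpha$, with the convention $\inf\emptyset=+\infty$. -/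

import Mathlib

open MeasureTheory Filter Set
open scoped Topology ENNReal

/-- `F` is the cdf of a probability distribution on the real line (a `StieltjesFunction` is monotone
and right-continuous). The distribution with cdf `F` is then `F.measure`. -/
def IsCdf (F : StieltjesFunction ℝ) : Prop :=
  Tendsto F atBot (𝓝 0) ∧ Tendsto F atTop (𝓝 1)

/-- The class of cdfs `F` that are differentiable on `[dlow, dbar]`, with `F dlow = 0`, and whose
derivative on `[dlow, dbar]` is at least `m` and Lipschitz with constant `K`. The derivatives at the
two endpoints are one-sided (a cdf vanishing at `dlow` has left derivative zero there). -/
def cdfClass (dlow dbar m K : ℝ) : Set (StieltjesFunction ℝ) :=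
  {F | IsCdf F ∧ DifferentiableOn ℝ F (Icc dlow dbar) ∧ F dlow = 0 ∧
    (∀ d ∈ Icc dlow dbar, m ≤ derivWithin F (Icc dlow dbar) d) ∧
    ∀ d₁ ∈ Icc dlow dbar, ∀ d ∈ Icc dlow dbar,
      |derivWithin F (Icc dlow dbar) d - derivWithin F (Icc dlow dbar) d₁| ≤ K * |d - d₁|}

/-- The `k`-th smallest of the `G` values `x 0, …, x (G - 1)`, counted with multiplicity, for
`1 ≤ k ≤ G` (and `0` for other `k`). -/
noncomputable def orderStat {G : ℕ} (x : Fin G → ℝ) (k : ℕ) : ℝ :=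
  if h : 1 ≤ k ∧ k ≤ G then x (Tuple.sort x ⟨k - 1, by omega⟩) else 0

/-- The test statistic `D₍₁₎ / (D₍₂₎ - D₍₁₎)` (equal to `0` in case of a tie `D₍₁₎ = D₍₂₎`). -/
noncomputable def testStat {G : ℕ} (x : Fin G → ℝ) : ℝ :=
  orderStat x 1 / (orderStat x 2 - orderStat x 1)

/-- The critical region of the test of nominal level `α`. -/
def critRegion (G : ℕ) (α : ℝ) : Set (Fin G → ℝ) :=
  {x | 1 / α - 1 < testStat x}

/-- The probability that the test rejects, for a sample of `G` i.i.d. draws with cdf `F`. -/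
noncomputable def rejProb (F : StieltjesFunction ℝ) (G : ℕ) (α : ℝ) : ℝ≥0∞ :=
  Measure.pi (fun _ : Fin G => F.measure) (critRegion G α)

/-! Put r = 1 - α, let δ and D be the endpoints of the interval, and let μ be the law with cdf F.
The test rejects when the minimum y is unique and some other draw is below y/r, so the rejection
probability is that of a unique minimum minus G ∫ μ[y/r, ∞)^(G-1) dμ(y) (`pi_critRegion_add`). The
first term is at least 1 - exp(-m G (D - δ)). In the second, only y within O(1/G) of δ matter. There
F is linear up to an error controlled by K uniformly over the class, so F(y/r) ≈ F(y)/r + f₀ δ α/r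
with slope f₀ ≥ m. Substituting v = F(y) leaves the integral of a power of an affine function, about
r exp(-f₀ G δ α/r). Hence if G δ ≥ c, the rejection probability is asymptotically at least 1 - (1 -
α) exp(-m c α/(1 - α)) (`eventually_forall_ofReal_le_rejProb`). This is α for c = 0, exceeds α for c
> 0, and tends to 1 as c → ∞. A matching upper bound is needed only for δ = 0
(`eventually_forall_rejProb_le_ofReal`). -/

/-! ### The rejection event and an exact formula for its probability -/

/-- The test rejects iff the minimum is attained only once and
some other value is smaller than the minimum divided by `1 - α`. -/
theorem mem_critRegion_iff {G : ℕ} (hG : 2 ≤ G) {α : ℝ} (hα0 : 0 < α) (hα1 : α < 1)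
    (x : Fin G → ℝ) :
    x ∈ critRegion G α ↔
      ∃ i, (∀ j, j ≠ i → x i < x j) ∧ ∃ j, j ≠ i ∧ x j < x i / (1 - α) := by
  have hr : 0 < 1 - α := by linarith
  set s := Tuple.sort x with hs
  have hmono : Monotone (x ∘ s) := Tuple.monotone_sort x
  have h1 : orderStat x 1 = x (s ⟨0, by omega⟩) := by
    simp only [orderStat]; rw [dif_pos ⟨le_rfl, by omega⟩]
  have h2 : orderStat x 2 = x (s ⟨1, by omega⟩) := by
    simp only [orderStat]; rw [dif_pos ⟨by omega, hG⟩]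
  set i₀ := s ⟨0, by omega⟩ with hi₀
  set i₁ := s ⟨1, by omega⟩ with hi₁
  have hne : i₁ ≠ i₀ := by
    intro h
    have := s.injective h
    simp at this
  have hmin : ∀ j, x i₀ ≤ x j := by
    intro j
    have : (⟨0, by omega⟩ : Fin G) ≤ s.symm j := by simp [Fin.le_def]
    simpa using hmono this
  have hsnd : ∀ j, j ≠ i₀ → x i₁ ≤ x j := by
    intro j hj
    have h0 : s.symm j ≠ ⟨0, by omega⟩ := by
      intro h; apply hj; rw [hi₀, ← h]; simp
    have : (⟨1, by omega⟩ : Fin G) ≤ s.symm j := by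
      rw [Fin.le_def]
      have : (s.symm j).val ≠ 0 := fun h => h0 (Fin.ext h)
      show 1 ≤ (s.symm j).val
      omega
    simpa using hmono this
  have hT : x ∈ critRegion G α ↔ x i₀ < x i₁ ∧ x i₁ < x i₀ / (1 - α) := by
    show 1 / α - 1 < testStat x ↔ _
    rw [testStat, h1, h2]
    have hc : 1 / α - 1 = (1 - α) / α := by field_simp
    have hc0 : 0 < (1 - α) / α := by positivity
    rw [hc]
    rcases (hmin i₁).eq_or_lt with h | h
    -- In a tie the statistic is x / 0 = 0, below the positive threshold.
    · rw [← h]; simp only [sub_self, div_zero, lt_irrefl, false_and, iff_false, not_lt]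
      exact hc0.le
    · have hd : 0 < x i₁ - x i₀ := by linarith
      rw [div_lt_div_iff₀ hα0 hd, lt_div_iff₀ hr]
      constructor
      · intro h'; exact ⟨h, by nlinarith⟩
      · rintro ⟨-, h'⟩; nlinarith
  rw [hT]
  constructor
  · rintro ⟨h, h'⟩
    exact ⟨i₀, fun j hj => h.trans_le (hsnd j hj), i₁, hne, h'⟩
  · rintro ⟨i, hi, j, hj, hji⟩
    have : i = i₀ := by
      by_contra hii
      exact absurd (hi i₀ (Ne.symm hii)) (not_lt.2 (hmin i))
    subst this
    exact ⟨hi _ hne, (hsnd j hj).trans_lt hji⟩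

theorem measurableSet_setOf_forall_ne {n : ℕ} {s : Set ℝ} (hs : MeasurableSet s)
    {T : Set (ℝ × ℝ)} (hT : MeasurableSet T) (i : Fin n) :
    MeasurableSet {x : Fin n → ℝ | x i ∈ s ∧ ∀ j, j ≠ i → (x i, x j) ∈ T} := by
  have : {x : Fin n → ℝ | x i ∈ s ∧ ∀ j, j ≠ i → (x i, x j) ∈ T} =
      (fun x => x i) ⁻¹' s ∩ ⋂ j, ⋂ (_ : j ≠ i), (fun x : Fin n → ℝ => (x i, x j)) ⁻¹' T := by
    ext x; simp
  rw [this]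
  refine (measurable_pi_apply i hs).inter
    (MeasurableSet.iInter fun j => MeasurableSet.iInter fun _ => ?_)
  exact ((measurable_pi_apply i).prodMk (measurable_pi_apply j)) hT

/-- Conditioning on coordinate `i`: given its value, the other `n` coordinates are independent. -/
theorem pi_setOf_forall_ne {n : ℕ} (μ : Measure ℝ) [IsProbabilityMeasure μ] {s : Set ℝ}
    (hs : MeasurableSet s) {T : Set (ℝ × ℝ)} (hT : MeasurableSet T) (i : Fin (n + 1)) :
    Measure.pi (fun _ : Fin (n + 1) => μ) {x | x i ∈ s ∧ ∀ j, j ≠ i → (x i, x j) ∈ T} =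
      ∫⁻ y in s, μ (Prod.mk y ⁻¹' T) ^ n ∂μ := by
  have hmp := measurePreserving_piFinSuccAbove (fun _ : Fin (n + 1) => μ) i
  have hset : {x : Fin (n + 1) → ℝ | x i ∈ s ∧ ∀ j, j ≠ i → (x i, x j) ∈ T} =
      (MeasurableEquiv.piFinSuccAbove (fun _ : Fin (n + 1) => ℝ) i) ⁻¹'
        {p : ℝ × (Fin n → ℝ) | p.1 ∈ s ∧ ∀ j, (p.1, p.2 j) ∈ T} := by
    ext x
    simp only [mem_ofPred_eq, mem_preimage, MeasurableEquiv.piFinSuccAbove_apply,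
      Fin.insertNthEquiv_symm_apply, Fin.removeNth]
    refine and_congr_right fun _ => ⟨fun h j => h _ (Fin.succAbove_ne i j), fun h j hj => ?_⟩
    obtain ⟨k, rfl⟩ := Fin.exists_succAbove_eq hj
    exact h k
  have hmeas : MeasurableSet {p : ℝ × (Fin n → ℝ) | p.1 ∈ s ∧ ∀ j, (p.1, p.2 j) ∈ T} := by
    have : {p : ℝ × (Fin n → ℝ) | p.1 ∈ s ∧ ∀ j, (p.1, p.2 j) ∈ T} =
        Prod.fst ⁻¹' s ∩ ⋂ j, (fun p : ℝ × (Fin n → ℝ) => (p.1, p.2 j)) ⁻¹' T := by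
      ext p; simp
    rw [this]
    refine (measurable_fst hs).inter (MeasurableSet.iInter fun j => ?_)
    exact (measurable_fst.prodMk ((measurable_pi_apply j).comp measurable_snd)) hT
  rw [hset, hmp.measure_preimage hmeas.nullMeasurableSet, Measure.prod_apply hmeas,
    ← lintegral_indicator hs]
  refine lintegral_congr fun y => ?_
  by_cases hy : y ∈ s
  · rw [indicator_of_mem hy]
    have : Prod.mk y ⁻¹' {p : ℝ × (Fin n → ℝ) | p.1 ∈ s ∧ ∀ j, (p.1, p.2 j) ∈ T} =
        univ.pi fun _ => Prod.mk y ⁻¹' T := by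
      ext q; simp [hy, Set.mem_pi]
    rw [this, Measure.pi_pi]; simp
  · rw [indicator_of_notMem hy]
    have : Prod.mk y ⁻¹' {p : ℝ × (Fin n → ℝ) | p.1 ∈ s ∧ ∀ j, (p.1, p.2 j) ∈ T} = ∅ := by
      ext q; simp [hy]
    rw [this, measure_empty]

theorem measurableSet_fst_lt_snd : MeasurableSet {p : ℝ × ℝ | p.1 < p.2} :=
  measurableSet_lt measurable_fst measurable_snd

/-- The event that the minimum of the sample is unique and exceeds `t` is contained in the event
that all values exceed `t`. -/
theorem mul_setLIntegral_Ioi_pow_le {n : ℕ} (μ : Measure ℝ) [IsProbabilityMeasure μ] (t : ℝ) :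
    (n + 1 : ℕ) * ∫⁻ y in Ioi t, μ (Ioi y) ^ n ∂μ ≤ μ (Ioi t) ^ (n + 1) := by
  let A : Fin (n + 1) → Set (Fin (n + 1) → ℝ) := fun i =>
    {x | x i ∈ Ioi t ∧ ∀ j, j ≠ i → (x i, x j) ∈ {p : ℝ × ℝ | p.1 < p.2}}
  have hA : ∀ i, Measure.pi (fun _ : Fin (n + 1) => μ) (A i) = ∫⁻ y in Ioi t, μ (Ioi y) ^ n ∂μ :=
    fun i => pi_setOf_forall_ne μ measurableSet_Ioi measurableSet_fst_lt_snd i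
  have hAm : ∀ i, MeasurableSet (A i) := by
    exact fun i => measurableSet_setOf_forall_ne measurableSet_Ioi measurableSet_fst_lt_snd i
  have hdisj : Pairwise (Function.onFun Disjoint A) := by
    intro i j hij
    refine Set.disjoint_left.2 fun x hi hj => ?_
    exact lt_asymm (show x i < x j from hi.2 j hij.symm) (show x j < x i from hj.2 i hij)
  have hsum : (n + 1 : ℕ) * ∫⁻ y in Ioi t, μ (Ioi y) ^ n ∂μ =
      Measure.pi (fun _ : Fin (n + 1) => μ) (⋃ i, A i) := by
    rw [measure_iUnion hdisj hAm, tsum_fintype]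
    simp [hA]
  have hpi : μ (Ioi t) ^ (n + 1) =
      Measure.pi (fun _ : Fin (n + 1) => μ) (univ.pi fun _ => Ioi t) := by
    rw [Measure.pi_pi]; simp
  rw [hsum, hpi]
  refine measure_mono (iUnion_subset fun i x hx => ?_)
  intro j _
  by_cases hj : j = i
  · subst hj; exact hx.1
  · exact lt_trans hx.1 (show x i < x j from hx.2 j hj)

/-- The rejection probability for positive i.i.d. draws: the probability of a unique minimum
minus the probability that all other values exceed the minimum by the factor `1 / (1 - α)`. -/
theorem pi_critRegion_add {n : ℕ} (hn : 1 ≤ n) (μ : Measure ℝ) [IsProbabilityMeasure μ]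
    (hμ : μ (Iic 0) = 0) {α : ℝ} (hα0 : 0 < α) (hα1 : α < 1) :
    Measure.pi (fun _ : Fin (n + 1) => μ) (critRegion (n + 1) α) +
        (n + 1 : ℕ) * ∫⁻ y in Ioi 0, μ (Ici (y / (1 - α))) ^ n ∂μ =
      (n + 1 : ℕ) * ∫⁻ y in Ioi 0, μ (Ioi y) ^ n ∂μ := by
  have hr : 0 < 1 - α := by linarith
  let P := Measure.pi (fun _ : Fin (n + 1) => μ)
  let A : Fin (n + 1) → Set (Fin (n + 1) → ℝ) := fun i =>
    {x | x i ∈ Ioi 0 ∧ ∀ j, j ≠ i → (x i, x j) ∈ {p : ℝ × ℝ | p.1 < p.2}}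
  let B : Fin (n + 1) → Set (Fin (n + 1) → ℝ) := fun i =>
    {x | x i ∈ Ioi 0 ∧ ∀ j, j ≠ i → (x i, x j) ∈ {p : ℝ × ℝ | p.1 / (1 - α) ≤ p.2}}
  have hA : ∀ i, P (A i) = ∫⁻ y in Ioi 0, μ (Ioi y) ^ n ∂μ :=
    fun i => pi_setOf_forall_ne μ measurableSet_Ioi measurableSet_fst_lt_snd i
  have hB : ∀ i, P (B i) = ∫⁻ y in Ioi 0, μ (Ici (y / (1 - α))) ^ n ∂μ :=
    fun i => pi_setOf_forall_ne μ measurableSet_Ioi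
      (measurableSet_le (measurable_fst.div_const _) measurable_snd) i
  have hAm : ∀ i, MeasurableSet (A i) := by
    exact fun i => measurableSet_setOf_forall_ne measurableSet_Ioi measurableSet_fst_lt_snd i
  have hBm : ∀ i, MeasurableSet (B i) := by
    exact fun i => measurableSet_setOf_forall_ne measurableSet_Ioi
      (measurableSet_le (measurable_fst.div_const _) measurable_snd) i
  have hBA : ∀ i, B i ⊆ A i := by
    intro i x hx
    refine ⟨hx.1, fun j hj => ?_⟩
    have h0 : 0 < x i := hx.1
    have : x i < x i / (1 - α) := by
      rw [lt_div_iff₀ hr]; nlinarith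
    exact this.trans_le (hx.2 j hj)
  have hdisj : Pairwise (Function.onFun Disjoint fun i => A i \ B i) := by
    intro i j hij
    refine Set.disjoint_left.2 fun x hi hj => ?_
    exact lt_asymm (show x i < x j from hi.1.2 j hij.symm) (show x j < x i from hj.1.2 i hij)
  -- Almost surely all draws are positive, so restricting the minimum to `Ioi 0` loses nothing;
  -- positivity is also what makes `B i ⊆ A i`.
  have hpos : ∀ᵐ x ∂P, ∀ i, 0 < x i := by
    rw [ae_all_iff]
    intro i
    have h := (measurePreserving_eval (fun _ : Fin (n + 1) => μ) i).quasiMeasurePreserving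
    have h0 : ∀ᵐ y ∂μ, 0 < y := by
      rw [ae_iff]; simpa [← Iic_def] using hμ
    exact h.ae h0
  have hW : critRegion (n + 1) α =ᵐ[P] ⋃ i, A i \ B i := by
    filter_upwards [hpos] with x hx
    refine propext ?_
    change x ∈ critRegion (n + 1) α ↔ x ∈ ⋃ i, A i \ B i
    rw [mem_critRegion_iff (by omega) hα0 hα1, mem_iUnion]
    refine exists_congr fun i => and_congr ?_ ?_
    · exact ⟨fun h => ⟨hx i, h⟩, fun h => h.2⟩
    · simp only [B, mem_ofPred_eq, mem_Ioi, hx i, true_and]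
      push Not
      rfl
  change P _ + _ = _
  rw [measure_congr hW, measure_iUnion hdisj fun i => (hAm i).diff (hBm i), tsum_fintype]
  have h1 : ((n + 1 : ℕ) : ℝ≥0∞) * ∫⁻ y in Ioi 0, μ (Ici (y / (1 - α))) ^ n ∂μ = ∑ i, P (B i) := by
    simp [hB]
  have h2 : ((n + 1 : ℕ) : ℝ≥0∞) * ∫⁻ y in Ioi 0, μ (Ioi y) ^ n ∂μ = ∑ i, P (A i) := by
    simp [hA]
  rw [h1, h2, ← Finset.sum_add_distrib]
  refine Finset.sum_congr rfl fun i _ => ?_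
  rw [measure_sdiff (hBA i) (hBm i).nullMeasurableSet (measure_ne_top _ _),
    tsub_add_cancel_of_le (measure_mono (hBA i))]

/-! ### Change of variables v = F(y) and the resulting integral -/

/-- The probability integral transform on an interval where the cdf is continuous and strictly
increasing. -/
theorem StieltjesFunction.map_measure_restrict_Ioc (F : StieltjesFunction ℝ) {a b : ℝ}
    (hab : a ≤ b) (hc : ContinuousOn F (Icc a b)) (hs : StrictMonoOn F (Icc a b)) :
    (F.measure.restrict (Ioc a b)).map F = volume.restrict (Ioc (F a) (F b)) := by
  have hfin : IsFiniteMeasure (F.measure.restrict (Ioc a b)) :=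
    ⟨by rw [Measure.restrict_apply_univ, F.measure_Ioc]; exact ENNReal.ofReal_lt_top⟩
  have hmeas : Measurable F := F.mono.measurable
  refine Measure.ext_of_Iic _ _ fun y => ?_
  rw [Measure.map_apply hmeas measurableSet_Iic,
    Measure.restrict_apply (hmeas measurableSet_Iic), Measure.restrict_apply measurableSet_Iic]
  rcases lt_or_ge y (F a) with h1 | h1
  · have e1 : F ⁻¹' Iic y ∩ Ioc a b = ∅ := by
      ext x
      simp only [mem_inter_iff, mem_preimage, mem_Iic, mem_Ioc, mem_empty_iff_false, iff_false]
      rintro ⟨h, h', -⟩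
      linarith [F.mono h'.le]
    have e2 : Iic y ∩ Ioc (F a) (F b) = ∅ := by
      ext x
      simp only [mem_inter_iff, mem_Iic, mem_Ioc, mem_empty_iff_false, iff_false]
      rintro ⟨h, h', -⟩
      linarith
    rw [e1, e2]; simp
  rcases le_or_gt (F b) y with h2 | h2
  · have e1 : F ⁻¹' Iic y ∩ Ioc a b = Ioc a b :=
      inter_eq_right.2 fun x hx => (F.mono hx.2).trans h2
    have e2 : Iic y ∩ Ioc (F a) (F b) = Ioc (F a) (F b) :=
      inter_eq_right.2 fun x hx => hx.2.trans h2
    rw [e1, e2, F.measure_Ioc, Real.volume_Ioc]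
  · obtain ⟨z, hz, rfl⟩ := intermediate_value_Icc hab hc ⟨h1, h2.le⟩
    have e1 : F ⁻¹' Iic (F z) ∩ Ioc a b = Ioc a z := by
      ext x
      simp only [mem_inter_iff, mem_preimage, mem_Iic, mem_Ioc]
      constructor
      · rintro ⟨h, h', h''⟩
        exact ⟨h', (hs.le_iff_le ⟨h'.le, h''⟩ hz).1 h⟩
      · rintro ⟨h, h'⟩
        exact ⟨F.mono h', h, h'.trans hz.2⟩
    have e2 : Iic (F z) ∩ Ioc (F a) (F b) = Ioc (F a) (F z) := by
      rw [inter_comm, Ioc_inter_Iic, min_eq_right h2.le]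
    rw [e1, e2, F.measure_Ioc, Real.volume_Ioc]

theorem StieltjesFunction.setLIntegral_comp_Ioc (F : StieltjesFunction ℝ) {a b : ℝ}
    (hab : a ≤ b) (hc : ContinuousOn F (Icc a b)) (hs : StrictMonoOn F (Icc a b))
    {φ : ℝ → ℝ≥0∞} (hφ : Measurable φ) :
    ∫⁻ x in Ioc a b, φ (F x) ∂F.measure = ∫⁻ v in Ioc (F a) (F b), φ v := by
  rw [← F.map_measure_restrict_Ioc hab hc hs, lintegral_map hφ F.mono.measurable]

/-- The hypothesis `b * V ≤ A` keeps the integrand's base nonnegative, so `ENNReal.ofReal` truncates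
nothing. -/
theorem mul_setLIntegral_sub_mul_pow (n : ℕ) {A b V : ℝ} (hb : 0 < b) (hV : 0 ≤ V)
    (h : b * V ≤ A) :
    (n + 1 : ℕ) * ∫⁻ v in Ioc 0 V, ENNReal.ofReal (A - b * v) ^ n =
      ENNReal.ofReal ((A ^ (n + 1) - (A - b * V) ^ (n + 1)) / b) := by
  have hint : ∫ v in (0 : ℝ)..V, (n + 1 : ℝ) * (A - b * v) ^ n =
      (A ^ (n + 1) - (A - b * V) ^ (n + 1)) / b := by
    have hd : ∀ x ∈ uIcc 0 V, HasDerivAt (fun v => -(A - b * v) ^ (n + 1) / b)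
        ((n + 1 : ℝ) * (A - b * x) ^ n) x := by
      intro x _
      have h1 : HasDerivAt (fun v => A - b * v) (-b) x := by
        simpa using ((hasDerivAt_id x).const_mul b).const_sub A
      have h2 := ((h1.pow (n + 1)).neg).div_const b
      refine h2.congr_deriv ?_
      push_cast
      field_simp
    rw [intervalIntegral.integral_eq_sub_of_hasDerivAt hd
      (Continuous.intervalIntegrable (by fun_prop) _ _)]
    simp only [mul_zero, sub_zero]
    ring
  rw [← hint, intervalIntegral.integral_of_le hV, ofReal_integral_eq_lintegral_ofReal,
    ← lintegral_const_mul _ (by fun_prop)]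
  · refine setLIntegral_congr_fun measurableSet_Ioc fun v hv => ?_
    have : 0 ≤ A - b * v := by nlinarith [hv.2]
    rw [ENNReal.ofReal_mul (by positivity), ENNReal.ofReal_pow this]
    congr 1
    rw [← Nat.cast_add_one, ENNReal.ofReal_natCast]
  · exact (Continuous.integrableOn_Icc (by fun_prop)).mono_set Ioc_subset_Icc_self
  · refine (ae_restrict_iff' measurableSet_Ioc).2 (.of_forall fun v hv => ?_)
    have : 0 ≤ A - b * v := by nlinarith [hv.2]
    simp only [Pi.zero_apply]
    positivity

/-! ### Elementary properties of the class and its first-order expansion -/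

namespace cdfClass

variable {δ D m K : ℝ} {F : StieltjesFunction ℝ}

theorem continuousOn (hF : F ∈ cdfClass δ D m K) : ContinuousOn F (Icc δ D) :=
  hF.2.1.continuousOn

theorem isProbabilityMeasure (hF : F ∈ cdfClass δ D m K) : IsProbabilityMeasure F.measure :=
  F.isProbabilityMeasure hF.1.1 hF.1.2

theorem apply_left (hF : F ∈ cdfClass δ D m K) : F δ = 0 := hF.2.2.1

theorem apply_le_one (hF : F ∈ cdfClass δ D m K) (x : ℝ) : F x ≤ 1 :=
  F.mono.ge_of_tendsto hF.1.2 x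

theorem measure_Iic_left (hF : F ∈ cdfClass δ D m K) : F.measure (Iic δ) = 0 := by
  rw [F.measure_Iic hF.1.1, apply_left hF]; simp

theorem measure_Ioi (hF : F ∈ cdfClass δ D m K) (x : ℝ) :
    F.measure (Ioi x) = ENNReal.ofReal (1 - F x) :=
  F.measure_Ioi hF.1.2 x

/-- Continuity of F from the left at `x` rules out an atom there; this is why `x = δ` is excluded.
-/
theorem measure_Ici (hF : F ∈ cdfClass δ D m K) {x : ℝ} (hx : x ∈ Ioc δ D) :
    F.measure (Ici x) = ENNReal.ofReal (1 - F x) := by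
  rw [F.measure_Ici hF.1.2, ContinuousWithinAt.leftLim_eq]
  have h := continuousOn hF x ⟨hx.1.le, hx.2⟩
  refine h.mono_of_mem_nhdsWithin ?_
  exact mem_of_superset (Icc_mem_nhdsLE hx.1) (Icc_subset_Icc_right hx.2)

theorem mul_sub_le (hF : F ∈ cdfClass δ D m K) {x y : ℝ} (hx : δ ≤ x) (hxy : x ≤ y)
    (hy : y ≤ D) : m * (y - x) ≤ F y - F x := by
  refine (convex_Icc δ D).mul_sub_le_image_sub_of_le_deriv (continuousOn hF)
    (hF.2.1.mono interior_subset) ?_ x ⟨hx, hxy.trans hy⟩ y ⟨hx.trans hxy, hy⟩ hxy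
  intro z hz
  rw [interior_Icc] at hz
  rw [← derivWithin_of_mem_nhds (Icc_mem_nhds hz.1 hz.2)]
  exact hF.2.2.2.1 z (Ioo_subset_Icc_self hz)

theorem strictMonoOn (hF : F ∈ cdfClass δ D m K) (hm : 0 < m) : StrictMonoOn F (Icc δ D) := by
  intro x hx y hy hxy
  have := mul_sub_le hF hx.1 hxy.le hy.2
  nlinarith

/-- `f₀` is the one-sided derivative at δ. The mean value inequality applies to F(x) - f₀ x, whose
derivative is at most K h in absolute value on [δ, δ + h]. -/
theorem exists_abs_sub_le (hF : F ∈ cdfClass δ D m K) (hK : 0 ≤ K) (hδ : δ ≤ D) :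
    ∃ f₀, m ≤ f₀ ∧ ∀ h, 0 ≤ h → δ + h ≤ D → |F (δ + h) - f₀ * h| ≤ K * h ^ 2 := by
  refine ⟨derivWithin F (Icc δ D) δ, hF.2.2.2.1 δ (left_mem_Icc.2 hδ), fun h h0 hD => ?_⟩
  set f₀ := derivWithin F (Icc δ D) δ
  have hsub : Icc δ (δ + h) ⊆ Icc δ D := Icc_subset_Icc_right hD
  have key := Convex.norm_image_sub_le_of_norm_hasDerivWithin_le
    (f := fun x => F x - f₀ * x) (f' := fun x => derivWithin F (Icc δ D) x - f₀)
    (s := Icc δ (δ + h)) (x := δ) (y := δ + h) (C := K * h) ?_ ?_ (convex_Icc _ _)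
    (left_mem_Icc.2 (by linarith)) (right_mem_Icc.2 (by linarith))
  · rw [apply_left hF, Real.norm_eq_abs, Real.norm_eq_abs] at key
    calc |F (δ + h) - f₀ * h| = |F (δ + h) - f₀ * (δ + h) - (0 - f₀ * δ)| := by ring_nf
      _ ≤ K * h * |δ + h - δ| := key
      _ = K * h ^ 2 := by rw [add_sub_cancel_left, abs_of_nonneg h0]; ring
  · intro x hx
    have h1 := ((hF.2.1 x (hsub hx)).hasDerivWithinAt).mono hsub
    have h2 : HasDerivWithinAt (fun x => f₀ * x) f₀ (Icc δ (δ + h)) x := by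
      simpa using (hasDerivWithinAt_id x _).const_mul f₀
    exact h1.sub h2
  · intro x hx
    have h1 := hF.2.2.2.2 δ (left_mem_Icc.2 hδ) x (hsub hx)
    rw [Real.norm_eq_abs]
    refine h1.trans (mul_le_mul_of_nonneg_left ?_ hK)
    rw [abs_of_nonneg (by linarith [hx.1])]
    linarith [hx.2]

end cdfClass

/-! ### Finite-sample bounds uniform over the class -/

namespace cdfClass

variable {δ D m K : ℝ} {F : StieltjesFunction ℝ}

/-- Minima in (δ, D] alone contribute 1 - (1 - F(D))^(n+1), and F(D) ≥ m (D - δ). -/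
theorem ofReal_le_mul_setLIntegral_Ioi (hF : F ∈ cdfClass δ D m K) (hm : 0 < m) (hδ : 0 ≤ δ)
    (hδD : δ < D) (n : ℕ) :
    ENNReal.ofReal (1 - Real.exp (-(m * ((n + 1 : ℕ) * (D - δ))))) ≤
      (n + 1 : ℕ) * ∫⁻ y in Ioi 0, F.measure (Ioi y) ^ n ∂F.measure := by
  have hs := strictMonoOn hF hm
  have hc := continuousOn hF
  have hFD : m * (D - δ) ≤ F D := by
    simpa [apply_left hF] using mul_sub_le hF le_rfl hδD.le le_rfl
  have hFD1 := apply_le_one hF D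
  have h1 : ∫⁻ y in Ioc δ D, ENNReal.ofReal (1 - 1 * F y) ^ n ∂F.measure ≤
      ∫⁻ y in Ioi 0, F.measure (Ioi y) ^ n ∂F.measure := by
    simp only [measure_Ioi hF, one_mul]
    exact lintegral_mono_set fun x hx => hδ.trans_lt hx.1
  refine le_trans ?_ (mul_le_mul_right h1 _)
  rw [F.setLIntegral_comp_Ioc (φ := fun v => ENNReal.ofReal (1 - 1 * v) ^ n) hδD.le hc hs
    (by fun_prop), apply_left hF, mul_setLIntegral_sub_mul_pow n one_pos
      (by nlinarith [sub_pos.2 hδD]) (by linarith)]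
  refine ENNReal.ofReal_le_ofReal ?_
  have h2 : (1 - F D) ^ (n + 1) ≤ Real.exp (-(m * (D - δ))) ^ (n + 1) := by
    refine pow_le_pow_left₀ (by linarith) ?_ _
    linarith [Real.one_sub_le_exp_neg (m * (D - δ))]
  have h3 : Real.exp (-(m * (D - δ))) ^ (n + 1) =
      Real.exp (-(m * ((n + 1 : ℕ) * (D - δ)))) := by
    rw [← Real.exp_nat_mul]; congr 1; ring
  rw [h3] at h2
  simp only [one_mul, one_pow, div_one]
  linarith

/-- Near the left endpoint, the tail mass beyond `x / r` is at most affine in `F x`. -/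
theorem measure_Ici_div_le_and (hF : F ∈ cdfClass δ D m K) (hm : 0 < m) (hK : 0 ≤ K)
    {r η M c N : ℝ} (hr0 : 0 < r) (hr1 : r < 1) (hη0 : 0 < η) (hη1 : η < 1)
    (hc : 0 ≤ c) (hN : 0 < N) (hcδ : c ≤ N * δ)
    (hD : (M + c * (1 - r)) / (r * N) ≤ D - δ)
    (hKM : K * ((M + c * (1 - r)) / (r * N)) ≤ η * m) {x : ℝ}
    (hx : x ∈ Ioc δ (δ + M / N)) :
    F.measure (Ici (x / r)) ≤ ENNReal.ofReal
      (1 - (1 - η) * m * c * (1 - r) / r / N - (1 - η) / ((1 + η) * r) * F x) ∧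
    (1 - η) / ((1 + η) * r) * F x ≤ 1 - (1 - η) * m * c * (1 - r) / r / N := by
  obtain ⟨u, rfl⟩ : ∃ u, x = δ + u := ⟨x - δ, by ring⟩
  have hu0 : 0 < u := by linarith [hx.1]
  have huM : u ≤ M / N := by linarith [hx.2]
  set H := (M + c * (1 - r)) / (r * N) with hH
  -- Since x/r - δ = u/r + δ (1 - r)/r and δ ≥ c/N, the point δ + h is at most x/r. `H` is the value
  -- of `h` at u = M/N; `hD` keeps δ + H inside the interval and `hKM` makes the quadratic error at
  -- most the fraction η of the linear term.
  set h := u / r + c * (1 - r) / (r * N) with hh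
  have hr1' : 0 < 1 - r := by linarith
  have hh0 : 0 < h := by positivity
  have hhH : h ≤ H := by
    have e : H = M / N / r + c * (1 - r) / (r * N) := by rw [hH]; field_simp
    rw [e, hh]; gcongr
  have huh : u ≤ h := by
    have h1 : u ≤ u / r := by rw [le_div_iff₀ hr0]; nlinarith
    have h2 : 0 ≤ c * (1 - r) / (r * N) := by positivity
    linarith
  obtain ⟨f₀, hf₀, hq⟩ := exists_abs_sub_le hF hK (by linarith)
  have hf0 : 0 < f₀ := by linarith
  have hquad : ∀ v, 0 ≤ v → v ≤ h → K * v ^ 2 ≤ η * f₀ * v := by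
    intro v hv0 hvh
    have : K * v ≤ η * f₀ :=
      calc K * v ≤ K * H := by gcongr; linarith
        _ ≤ η * m := hKM
        _ ≤ η * f₀ := by gcongr
    nlinarith
  have hyF : (1 - η) * f₀ * h ≤ F (δ + h) := by
    have h1 := (abs_le.1 (hq h hh0.le (by linarith))).1
    linarith [hquad h hh0.le le_rfl]
  have hxF : F (δ + u) ≤ (1 + η) * f₀ * u := by
    have h1 := (abs_le.1 (hq u hu0.le (by linarith))).2
    linarith [hquad u hu0.le huh]
  have hη1' : 0 < 1 - η := by linarith
  have hbound : (1 - η) * m * c * (1 - r) / r / N + (1 - η) / ((1 + η) * r) * F (δ + u) ≤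
      F (δ + h) := by
    refine le_trans ?_ hyF
    have e1 : (1 - η) / ((1 + η) * r) * F (δ + u) ≤ (1 - η) * f₀ * (u / r) := by
      calc (1 - η) / ((1 + η) * r) * F (δ + u)
          ≤ (1 - η) / ((1 + η) * r) * ((1 + η) * f₀ * u) := by gcongr
        _ = (1 - η) * f₀ * (u / r) := by field_simp
    have e2 : (1 - η) * m * c * (1 - r) / r / N ≤ (1 - η) * f₀ * (c * (1 - r) / (r * N)) := by
      calc (1 - η) * m * c * (1 - r) / r / N = (1 - η) * m * (c * (1 - r) / (r * N)) := by
            field_simp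
        _ ≤ _ := by gcongr
    rw [hh, mul_add]; linarith
  refine ⟨?_, by linarith [apply_le_one hF (δ + h)]⟩
  have hle : δ + h ≤ (δ + u) / r := by
    have e : (δ + u) / r = δ + u / r + δ * (1 - r) / r := by field_simp; ring
    have e' : c * (1 - r) / (r * N) ≤ δ * (1 - r) / r := by
      rw [div_le_div_iff₀ (by positivity) hr0]
      nlinarith [mul_le_mul_of_nonneg_right hcδ (mul_pos hr1' hr0).le]
    rw [e, hh]; linarith
  calc F.measure (Ici ((δ + u) / r)) ≤ F.measure (Ici (δ + h)) :=
        measure_mono (Ici_subset_Ici.2 hle)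
    _ = ENNReal.ofReal (1 - F (δ + h)) := measure_Ici hF ⟨by linarith, by linarith⟩
    _ ≤ _ := ENNReal.ofReal_le_ofReal (by linarith)

/-- The two exponentials bound the contributions of minima within M/N of δ and beyond. The factor r
(1 + η)/(1 - η) is the reciprocal of the slope `b` in the affine bound on the tail. -/
theorem mul_setLIntegral_Ici_div_le (hF : F ∈ cdfClass δ D m K) (hm : 0 < m) (hK : 0 ≤ K)
    (hδ : 0 ≤ δ) {r η M c : ℝ} (hr0 : 0 < r) (hr1 : r < 1) (hη0 : 0 < η) (hη1 : η < 1)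
    (hM : 0 < M) (hc : 0 ≤ c) (n : ℕ) (hcδ : c ≤ (n + 1 : ℕ) * δ)
    (hD : (M + c * (1 - r)) / (r * (n + 1 : ℕ)) ≤ D - δ)
    (hKM : K * ((M + c * (1 - r)) / (r * (n + 1 : ℕ))) ≤ η * m) :
    (n + 1 : ℕ) * ∫⁻ y in Ioi 0, F.measure (Ici (y / r)) ^ n ∂F.measure ≤
      ENNReal.ofReal (r * (1 + η) / (1 - η) * Real.exp (-((1 - η) * m * c * (1 - r) / r)) +
        Real.exp (-(m * M))) := by
  have := isProbabilityMeasure hF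
  set N : ℝ := ((n + 1 : ℕ) : ℝ) with hNdef
  have hN : 0 < N := by positivity
  set t := δ + M / N with ht
  set κ := (1 - η) * m * c * (1 - r) / r with hκ
  set b := (1 - η) / ((1 + η) * r) with hb
  have hη1' : 0 < 1 - η := by linarith
  have hr1' : 0 < 1 - r := by linarith
  have hb0 : 0 < b := by positivity
  have hMN : 0 < M / N := by positivity
  have htD : t ≤ D := by
    have h1 : M / N ≤ (M + c * (1 - r)) / (r * N) := by
      rw [div_le_div_iff₀ hN (by positivity)]
      have h3 : 0 ≤ c * (1 - r) * N := by positivity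
      nlinarith [mul_pos (mul_pos hM hr1') hN]
    linarith
  have hpt := fun x (hx : x ∈ Ioc δ t) =>
    measure_Ici_div_le_and hF hm hK hr0 hr1 hη0 hη1 hc hN hcδ hD hKM hx
  have hFt : m * (M / N) ≤ F t := by
    simpa [apply_left hF, ht] using mul_sub_le hF le_rfl (by linarith : δ ≤ t) htD
  -- the part near the left endpoint
  have hnear : (n + 1 : ℕ) * ∫⁻ y in Ioc δ t, F.measure (Ici (y / r)) ^ n ∂F.measure ≤
      ENNReal.ofReal (r * (1 + η) / (1 - η) * Real.exp (-κ)) := by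
    have h1 : ∫⁻ y in Ioc δ t, F.measure (Ici (y / r)) ^ n ∂F.measure ≤
        ∫⁻ y in Ioc δ t, ENNReal.ofReal (1 - κ / N - b * F y) ^ n ∂F.measure :=
      setLIntegral_mono' measurableSet_Ioc fun x hx => pow_le_pow_left₀ (zero_le) (hpt x hx).1 n
    have hsub : Icc δ t ⊆ Icc δ D := Icc_subset_Icc_right htD
    have hbt : b * F t ≤ 1 - κ / N := (hpt t ⟨by linarith, le_rfl⟩).2
    have hFt0 : 0 ≤ F t := le_trans (by positivity) hFt
    refine (mul_le_mul_right h1 _).trans ?_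
    rw [F.setLIntegral_comp_Ioc (φ := fun v => ENNReal.ofReal (1 - κ / N - b * v) ^ n)
      (by linarith) ((continuousOn hF).mono hsub) ((strictMonoOn hF hm).mono hsub)
      (by fun_prop), apply_left hF, mul_setLIntegral_sub_mul_pow n hb0 hFt0 hbt]
    refine ENNReal.ofReal_le_ofReal ?_
    have hA0 : 0 ≤ 1 - κ / N := le_trans (by positivity) hbt
    have hA : (1 - κ / N) ^ (n + 1) ≤ Real.exp (-κ) := by
      calc (1 - κ / N) ^ (n + 1) ≤ Real.exp (-(κ / N)) ^ (n + 1) :=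
            pow_le_pow_left₀ hA0 (Real.one_sub_le_exp_neg _) _
        _ = Real.exp (-κ) := by
            rw [← Real.exp_nat_mul, ← hNdef]; congr 1; field_simp
    have hV : 0 ≤ (1 - κ / N - b * F t) ^ (n + 1) := pow_nonneg (by linarith) _
    calc ((1 - κ / N) ^ (n + 1) - (1 - κ / N - b * F t) ^ (n + 1)) / b ≤ Real.exp (-κ) / b := by
          gcongr; linarith
      _ = _ := by rw [hb]; field_simp
  -- Here the factor 1/r is not needed: all draws exceed `t`, which has probability (1 - F(t))^(n+1)
  -- ≤ exp(-m M).
  have hfar : (n + 1 : ℕ) * ∫⁻ y in Ioi t, F.measure (Ici (y / r)) ^ n ∂F.measure ≤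
      ENNReal.ofReal (Real.exp (-(m * M))) := by
    have h1 : ∫⁻ y in Ioi t, F.measure (Ici (y / r)) ^ n ∂F.measure ≤
        ∫⁻ y in Ioi t, F.measure (Ioi y) ^ n ∂F.measure := by
      refine setLIntegral_mono' measurableSet_Ioi fun x hx =>
        pow_le_pow_left₀ (zero_le) (measure_mono fun z hz => ?_) n
      have hx0 : 0 < x := by have : t < x := hx; linarith
      have : x < x / r := by rw [lt_div_iff₀ hr0]; nlinarith
      exact this.trans_le hz
    refine (mul_le_mul_right h1 _).trans ((mul_setLIntegral_Ioi_pow_le F.measure t).trans ?_)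
    have h0 := apply_le_one hF t
    rw [measure_Ioi hF, ← ENNReal.ofReal_pow (by linarith)]
    refine ENNReal.ofReal_le_ofReal ?_
    calc (1 - F t) ^ (n + 1) ≤ Real.exp (-(m * (M / N))) ^ (n + 1) := by
          refine pow_le_pow_left₀ (by linarith) ?_ _
          linarith [Real.one_sub_le_exp_neg (m * (M / N))]
      _ = Real.exp (-(m * M)) := by
          rw [← Real.exp_nat_mul, ← hNdef]; congr 1; field_simp
  have hsplit : ∫⁻ y in Ioi 0, F.measure (Ici (y / r)) ^ n ∂F.measure ≤
      ∫⁻ y in Ioc δ t, F.measure (Ici (y / r)) ^ n ∂F.measure +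
        ∫⁻ y in Ioi t, F.measure (Ici (y / r)) ^ n ∂F.measure := by
    calc ∫⁻ y in Ioi 0, F.measure (Ici (y / r)) ^ n ∂F.measure
        ≤ ∫⁻ y in Iic δ ∪ (Ioc δ t ∪ Ioi t), F.measure (Ici (y / r)) ^ n ∂F.measure := by
          refine lintegral_mono_set fun x _ => ?_
          rw [Ioc_union_Ioi_eq_Ioi (by linarith), Iic_union_Ioi]; trivial
      _ ≤ ∫⁻ y in Iic δ, F.measure (Ici (y / r)) ^ n ∂F.measure +
          ∫⁻ y in Ioc δ t ∪ Ioi t, F.measure (Ici (y / r)) ^ n ∂F.measure :=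
          lintegral_union_le _ _ _
      _ = ∫⁻ y in Ioc δ t ∪ Ioi t, F.measure (Ici (y / r)) ^ n ∂F.measure := by
          rw [setLIntegral_measure_zero _ _ (measure_Iic_left hF), zero_add]
      _ ≤ _ := lintegral_union_le _ _ _
  calc (n + 1 : ℕ) * ∫⁻ y in Ioi 0, F.measure (Ici (y / r)) ^ n ∂F.measure
      ≤ _ := mul_le_mul_right hsplit _
    _ ≤ ENNReal.ofReal (r * (1 + η) / (1 - η) * Real.exp (-κ)) +
        ENNReal.ofReal (Real.exp (-(m * M))) := by
        rw [mul_add]; exact add_le_add hnear hfar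
    _ = _ := (ENNReal.ofReal_add (by positivity) (by positivity)).symm

theorem measure_Iic_zero (hF : F ∈ cdfClass δ D m K) (hδ : 0 ≤ δ) : F.measure (Iic 0) = 0 :=
  measure_mono_null (Iic_subset_Iic.2 hδ) (measure_Iic_left hF)

theorem le_rejProb (hF : F ∈ cdfClass δ D m K) (hm : 0 < m) (hK : 0 ≤ K)
    (hδ : 0 ≤ δ) (hδD : δ < D) {α η M c : ℝ} (hα0 : 0 < α) (hα1 : α < 1) (hη0 : 0 < η)
    (hη1 : η < 1) (hM : 0 < M) (hc : 0 ≤ c) {n : ℕ} (hn : 1 ≤ n) (hcδ : c ≤ (n + 1 : ℕ) * δ)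
    (hD : (M + c * α) / ((1 - α) * (n + 1 : ℕ)) ≤ D - δ)
    (hKM : K * ((M + c * α) / ((1 - α) * (n + 1 : ℕ))) ≤ η * m) :
    ENNReal.ofReal (1 - Real.exp (-(m * ((n + 1 : ℕ) * (D - δ)))) -
      ((1 - α) * (1 + η) / (1 - η) * Real.exp (-((1 - η) * m * c * α / (1 - α))) +
        Real.exp (-(m * M)))) ≤ rejProb F (n + 1) α := by
  have := isProbabilityMeasure hF
  have hU := ofReal_le_mul_setLIntegral_Ioi hF hm hδ hδD n
  have hS := mul_setLIntegral_Ici_div_le hF hm hK hδ (r := 1 - α) (by linarith) (by linarith)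
    hη0 hη1 hM hc n hcδ (by simpa using hD) (by simpa using hKM)
  have hadd := pi_critRegion_add hn F.measure (measure_Iic_zero hF hδ) hα0 hα1
  rw [sub_sub_cancel] at hS
  have hη1' : 0 < 1 - η := by linarith
  have hr : 0 < 1 - α := by linarith
  rw [ENNReal.ofReal_sub _ (by positivity), tsub_le_iff_right]
  refine hU.trans ?_
  rw [← hadd]
  exact add_le_add le_rfl hS

/-- With δ = 0 there is no shift, and near 0 linearity gives F(x/r) ≤ a F(x) with `a` close to 1/r.
A lower bound may discard all minima above a fixed ε. -/
theorem ofReal_le_mul_setLIntegral_Ici_div (hF : F ∈ cdfClass 0 D m K) (hm : 0 < m) (hK : 0 ≤ K)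
    {r η ε : ℝ} (hr0 : 0 < r) (hr1 : r < 1) (hη0 : 0 < η) (hη1 : η < 1) (hε : 0 < ε)
    (hD : ε / r ≤ D) (hKε : K * (ε / r) ≤ η * m) (n : ℕ) :
    ENNReal.ofReal ((1 - Real.exp (-(m * ε * (n + 1 : ℕ)))) * (r * (1 - η) / (1 + η))) ≤
      (n + 1 : ℕ) * ∫⁻ y in Ioi 0, F.measure (Ici (y / r)) ^ n ∂F.measure := by
  have hη1' : 0 < 1 - η := by linarith
  set a := (1 + η) / ((1 - η) * r) with ha
  have ha1 : 1 ≤ a := by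
    rw [ha, one_le_div (by positivity)]; nlinarith
  have ha0 : 0 < a := by linarith
  have hεr : ε ≤ ε / r := by rw [le_div_iff₀ hr0]; nlinarith
  obtain ⟨f₀, hf₀, hq⟩ := exists_abs_sub_le hF hK (by linarith)
  have hf0 : 0 < f₀ := by linarith
  have hquad : ∀ v, 0 ≤ v → v ≤ ε / r → K * v ^ 2 ≤ η * f₀ * v := by
    intro v hv0 hvh
    have : K * v ≤ η * f₀ :=
      calc K * v ≤ K * (ε / r) := by gcongr
        _ ≤ η * m := hKε
        _ ≤ η * f₀ := by gcongr
    nlinarith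
  have hpt : ∀ x ∈ Ioc 0 ε, ENNReal.ofReal (1 - a * F x) ≤ F.measure (Ici (x / r)) := by
    intro x hx
    have hx0 : 0 < x := hx.1
    have hxr : x / r ≤ ε / r := by have := hx.2; gcongr
    have hxr0 : 0 < x / r := by positivity
    rw [measure_Ici hF ⟨hxr0, hxr.trans hD⟩]
    refine ENNReal.ofReal_le_ofReal ?_
    have h1 := (abs_le.1 (hq (x / r) hxr0.le (by linarith))).2
    have h2 := (abs_le.1 (hq x hx0.le (by linarith [hx.2]))).1
    rw [zero_add] at h1 h2
    have h3 := hquad (x / r) hxr0.le hxr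
    have h4 := hquad x hx0.le (hx.2.trans hεr)
    have h5 : a * ((1 - η) * f₀ * x) ≤ a * F x := by gcongr; linarith
    have h6 : a * ((1 - η) * f₀ * x) = (1 + η) * f₀ * (x / r) := by rw [ha]; field_simp
    linarith
  -- Cutting at 1/a keeps 1 - a v nonnegative, as the closed form of the integral requires.
  set V := min (F ε) (1 / a) with hV
  have hFε : m * ε ≤ F ε := by
    simpa [apply_left hF] using mul_sub_le hF le_rfl hε.le (hεr.trans hD)
  have hV0 : 0 ≤ V := le_min (le_trans (by positivity) hFε) (by positivity)
  have haV : a * V ≤ 1 := by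
    calc a * V ≤ a * (1 / a) := by gcongr; exact min_le_right _ _
      _ = 1 := by field_simp
  have hsub : Icc 0 ε ⊆ Icc 0 D := Icc_subset_Icc_right (hεr.trans hD)
  have hint : ∫⁻ v in Ioc 0 V, ENNReal.ofReal (1 - a * v) ^ n ≤
      ∫⁻ y in Ioi 0, F.measure (Ici (y / r)) ^ n ∂F.measure := by
    calc ∫⁻ v in Ioc 0 V, ENNReal.ofReal (1 - a * v) ^ n
        ≤ ∫⁻ v in Ioc (F 0) (F ε), ENNReal.ofReal (1 - a * v) ^ n := by
          rw [apply_left hF]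
          exact lintegral_mono_set (Ioc_subset_Ioc_right (min_le_left _ _))
      _ = ∫⁻ y in Ioc 0 ε, ENNReal.ofReal (1 - a * F y) ^ n ∂F.measure :=
          (F.setLIntegral_comp_Ioc (φ := fun v => ENNReal.ofReal (1 - a * v) ^ n) hε.le
            ((continuousOn hF).mono hsub) ((strictMonoOn hF hm).mono hsub) (by fun_prop)).symm
      _ ≤ ∫⁻ y in Ioc 0 ε, F.measure (Ici (y / r)) ^ n ∂F.measure :=
          setLIntegral_mono' measurableSet_Ioc fun x hx =>
            pow_le_pow_left₀ (zero_le) (hpt x hx) n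
      _ ≤ _ := lintegral_mono_set Ioc_subset_Ioi_self
  refine le_trans ?_ (mul_le_mul_right hint _)
  rw [mul_setLIntegral_sub_mul_pow n ha0 hV0 haV]
  refine ENNReal.ofReal_le_ofReal ?_
  have hexp : (1 - a * V) ^ (n + 1) ≤ Real.exp (-(m * ε * (n + 1 : ℕ))) := by
    have h1 : 1 - a * V ≤ Real.exp (-(m * ε)) := by
      rcases le_total (F ε) (1 / a) with h | h
      · rw [hV, min_eq_left h]
        have : m * ε ≤ a * F ε := by nlinarith [mul_pos hm hε]
        linarith [Real.one_sub_le_exp_neg (m * ε)]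
      · rw [hV, min_eq_right h, mul_one_div_cancel ha0.ne', sub_self]
        positivity
    calc (1 - a * V) ^ (n + 1) ≤ Real.exp (-(m * ε)) ^ (n + 1) :=
          pow_le_pow_left₀ (by linarith) h1 _
      _ = _ := by rw [← Real.exp_nat_mul]; congr 1; ring
  have e : r * (1 - η) / (1 + η) = 1 / a := by rw [ha]; field_simp
  rw [e, one_pow, ← div_eq_mul_one_div]
  gcongr

/-- The probability of a unique minimum is bounded by 1, so only the subtracted integral has to be
bounded below. -/
theorem rejProb_le (hF : F ∈ cdfClass 0 D m K) (hm : 0 < m) (hK : 0 ≤ K)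
    {α η ε : ℝ} (hα0 : 0 < α) (hα1 : α < 1) (hη0 : 0 < η) (hη1 : η < 1) (hε : 0 < ε)
    (hD : ε / (1 - α) ≤ D) (hKε : K * (ε / (1 - α)) ≤ η * m) {n : ℕ} (hn : 1 ≤ n) :
    rejProb F (n + 1) α ≤ ENNReal.ofReal
      (1 - (1 - Real.exp (-(m * ε * (n + 1 : ℕ)))) * ((1 - α) * (1 - η) / (1 + η))) := by
  have := isProbabilityMeasure hF
  have hS := ofReal_le_mul_setLIntegral_Ici_div hF hm hK (r := 1 - α) (by linarith)
    (by linarith) hη0 hη1 hε hD hKε n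
  have hadd := pi_critRegion_add hn F.measure (measure_Iic_zero hF le_rfl) hα0 hα1
  have hU : (n + 1 : ℕ) * ∫⁻ y in Ioi 0, F.measure (Ioi y) ^ n ∂F.measure ≤ 1 :=
    (mul_setLIntegral_Ioi_pow_le F.measure 0).trans (pow_le_one' prob_le_one _)
  have hη1' : 0 < 1 - η := by linarith
  have hr : 0 < 1 - α := by linarith
  have hexp : Real.exp (-(m * ε * (n + 1 : ℕ))) ≤ 1 :=
    Real.exp_le_one_iff.2 (neg_nonpos.2 (by positivity))
  rw [ENNReal.ofReal_sub _ (mul_nonneg (by linarith) (by positivity)), ENNReal.ofReal_one]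
  refine ENNReal.le_sub_of_add_le_right ENNReal.ofReal_ne_top ?_
  refine le_trans ?_ hU
  rw [← hadd]
  exact add_le_add le_rfl hS

end cdfClass

/-! ### Asymptotics and the three claims -/

/-- An asymptotic lower bound on the rejection probability, uniform over classes of cdfs whose left
endpoint is at least `c / G`. -/
theorem eventually_forall_ofReal_le_rejProb {α D m K c q : ℝ} (hα0 : 0 < α) (hα1 : α < 1)
    (hm : 0 < m) (hK : 0 ≤ K) (hc : 0 ≤ c)
    (hq : q < 1 - (1 - α) * Real.exp (-(m * c * α / (1 - α)))) {δ : ℕ → ℝ}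
    (hδ : ∀ᶠ G in atTop, 0 ≤ δ G ∧ δ G < D) (hcδ : ∀ᶠ G : ℕ in atTop, c ≤ G * δ G)
    (hL : Tendsto (fun G : ℕ => (G : ℝ) * (D - δ G)) atTop atTop) :
    ∀ᶠ G in atTop, ∀ F ∈ cdfClass (δ G) D m K, ENNReal.ofReal q ≤ rejProb F G α := by
  have hr : 0 < 1 - α := by linarith
  -- At η = 0 the inequality is `hq`, so by continuity it persists for small η > 0.
  obtain ⟨η, ⟨hη0, hη1⟩, hη⟩ : ∃ η ∈ Ioo (0 : ℝ) 1,
      (1 - α) * (1 + η) / (1 - η) * Real.exp (-((1 - η) * m * c * α / (1 - α))) < 1 - q := by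
    have hcont : ContinuousAt (fun η : ℝ => (1 - α) * (1 + η) / (1 - η) *
        Real.exp (-((1 - η) * m * c * α / (1 - α)))) 0 := by
      refine ContinuousAt.mul (ContinuousAt.div (by fun_prop) (by fun_prop) (by norm_num))
        (by fun_prop)
    have hlt : ∀ᶠ η in 𝓝 (0 : ℝ), (1 - α) * (1 + η) / (1 - η) *
        Real.exp (-((1 - η) * m * c * α / (1 - α))) < 1 - q := by
      refine hcont.eventually_lt_const ?_
      simp only [add_zero, sub_zero, mul_one, div_one, one_mul]
      linarith
    obtain ⟨η, h1, h2⟩ := ((hlt.filter_mono nhdsWithin_le_nhds).and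
      (Ioo_mem_nhdsGT (zero_lt_one' ℝ))).exists
    exact ⟨η, h2, h1⟩
  set g := (1 - α) * (1 + η) / (1 - η) * Real.exp (-((1 - η) * m * c * α / (1 - α))) with hg
  -- Half of the slack goes to minima beyond M/G, half to the chance of no unique minimum in (δ, D].
  have hs : 0 < (1 - q - g) / 2 := by linarith
  have hexp : Tendsto (fun x : ℝ => Real.exp (-(m * x))) atTop (𝓝 0) :=
    Real.tendsto_exp_neg_atTop_nhds_zero.comp (tendsto_id.const_mul_atTop hm)
  obtain ⟨M, hM, hM0⟩ := ((hexp.eventually_lt_const hs).and (eventually_gt_atTop 0)).exists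
  have hsmall : Tendsto (fun G : ℕ => K * ((M + c * α) / ((1 - α) * G))) atTop (𝓝 0) := by
    have h1 : Tendsto (fun G : ℕ => (1 - α) * (G : ℝ)) atTop atTop :=
      tendsto_natCast_atTop_atTop.const_mul_atTop hr
    simpa using (h1.const_div_atTop (M + c * α)).const_mul K
  filter_upwards [hδ, hcδ, (hexp.comp hL).eventually_lt_const hs,
    hsmall.eventually_le_const (mul_pos hη0 hm),
    hL.eventually_ge_atTop ((M + c * α) / (1 - α)), eventually_ge_atTop 2]
    with G h1 h2 h3 h4 h5 h6 F hF
  obtain ⟨n, rfl⟩ : ∃ n, G = n + 1 := ⟨G - 1, by omega⟩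
  have hN : (0 : ℝ) < (n + 1 : ℕ) := by positivity
  refine le_trans (ENNReal.ofReal_le_ofReal ?_) (cdfClass.le_rejProb hF hm hK h1.1 h1.2 hα0 hα1
    hη0 hη1 hM0 hc (by omega) h2 ?_ h4)
  · simp only [Function.comp_apply] at h3
    linarith
  · rw [← div_div, div_le_iff₀ hN]
    linarith

/-- An asymptotic upper bound on the rejection probability, uniform over the null hypothesis. -/
theorem eventually_forall_rejProb_le_ofReal {α D m K q : ℝ} (hα0 : 0 < α) (hα1 : α < 1)
    (hm : 0 < m) (hK : 0 < K) (hD : 0 < D) (hq : α < q) :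
    ∀ᶠ G in atTop, ∀ F ∈ cdfClass 0 D m K, rejProb F G α ≤ ENNReal.ofReal q := by
  have hr : 0 < 1 - α := by linarith
  obtain ⟨η, ⟨hη0, hη1⟩, hη⟩ : ∃ η ∈ Ioo (0 : ℝ) 1, 1 - (1 - α) * (1 - η) / (1 + η) < q := by
    have hcont : ContinuousAt (fun η : ℝ => 1 - (1 - α) * (1 - η) / (1 + η)) 0 :=
      ContinuousAt.sub (by fun_prop)
        (ContinuousAt.div (by fun_prop) (by fun_prop) (by norm_num))
    have hlt : ∀ᶠ η in 𝓝 (0 : ℝ), 1 - (1 - α) * (1 - η) / (1 + η) < q := by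
      refine hcont.eventually_lt_const ?_
      simpa using hq
    obtain ⟨η, h1, h2⟩ := ((hlt.filter_mono nhdsWithin_le_nhds).and
      (Ioo_mem_nhdsGT (zero_lt_one' ℝ))).exists
    exact ⟨η, h2, h1⟩
  -- `s` plays the role of ε/(1 - α): it fits in the interval and keeps the quadratic error below
  -- the fraction η.
  set s := min D (η * m / K) with hs
  have hs0 : 0 < s := lt_min hD (by positivity)
  have hsr : (1 - α) * s / (1 - α) = s := by field_simp
  have hsK : K * s ≤ η * m := by
    calc K * s ≤ K * (η * m / K) := by gcongr; exact min_le_right _ _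
      _ = η * m := by field_simp
  have hexp : Tendsto (fun G : ℕ => Real.exp (-(m * ((1 - α) * s) * (G : ℝ)))) atTop (𝓝 0) :=
    Real.tendsto_exp_neg_atTop_nhds_zero.comp
      (tendsto_natCast_atTop_atTop.const_mul_atTop (by positivity))
  have hlim : Tendsto (fun G : ℕ => 1 - (1 - Real.exp (-(m * ((1 - α) * s) * (G : ℝ)))) *
      ((1 - α) * (1 - η) / (1 + η))) atTop (𝓝 (1 - (1 - 0) * ((1 - α) * (1 - η) / (1 + η)))) :=
    ((hexp.const_sub 1).mul_const _).const_sub 1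
  filter_upwards [hlim.eventually_lt_const (by simpa using hη), eventually_ge_atTop 2]
    with G h1 h2 F hF
  obtain ⟨n, rfl⟩ : ∃ n, G = n + 1 := ⟨G - 1, by omega⟩
  refine (cdfClass.rejProb_le hF hm hK.le hα0 hα1 hη0 hη1 (ε := (1 - α) * s) (by positivity)
    ?_ ?_ (by omega)).trans (ENNReal.ofReal_le_ofReal h1.le)
  · rw [hsr]; exact min_le_left _ _
  · rwa [hsr]

theorem rejProb_le_one {δ D m K : ℝ} {F : StieltjesFunction ℝ} (hF : F ∈ cdfClass δ D m K)
    (G : ℕ) (α : ℝ) : rejProb F G α ≤ 1 := by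
  have := cdfClass.isProbabilityMeasure hF
  exact prob_le_one

theorem theorem4 (α dlow dbar m K : ℝ) (hα0 : 0 < α) (hα1 : α < 1) (hlow : 0 < dlow)
    (hbar : dlow < dbar) (hm : 0 < m) (hK : 0 < K) :
    -- asymptotic size
    ((cdfClass 0 dbar m K).Nonempty →
      limsup (fun G : ℕ => ⨆ F ∈ cdfClass 0 dbar m K, rejProb F G α) atTop = ENNReal.ofReal α) ∧
    -- uniform consistency
    ((cdfClass dlow dbar m K).Nonempty →
      liminf (fun G : ℕ => ⨅ F ∈ cdfClass dlow dbar m K, rejProb F G α) atTop = 1) ∧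
    -- local power
    (∀ δ : ℕ → ℝ, (∀ G, 1 ≤ G → 0 ≤ δ G ∧ δ G < dbar) →
      0 < liminf (fun G : ℕ => (((G : ℝ) * δ G : ℝ) : EReal)) atTop →
      Tendsto (fun G : ℕ => (G : ℝ) * (dbar - δ G)) atTop atTop →
      ENNReal.ofReal α <
        liminf (fun G : ℕ => ⨅ F ∈ cdfClass (δ G) dbar m K, rejProb F G α) atTop) := by
  have hD : 0 < dbar := hlow.trans hbar
  have htend : ∀ d, d < dbar → Tendsto (fun G : ℕ => (G : ℝ) * (dbar - d)) atTop atTop :=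
    fun d hd => tendsto_natCast_atTop_atTop.atTop_mul_const (sub_pos.2 hd)
  refine ⟨fun ⟨F, hF⟩ => le_antisymm ?_ ?_, fun ⟨F, hF⟩ => le_antisymm ?_ ?_, ?_⟩
  · refine le_of_forall_gt_imp_ge_of_dense fun b hb => ?_
    rcases eq_or_ne b ⊤ with rfl | hbt
    · exact le_top
    have hb' : α < b.toReal := (ENNReal.ofReal_lt_iff_lt_toReal hα0.le hbt).1 hb
    rw [← ENNReal.ofReal_toReal hbt]
    refine limsup_le_of_le (by isBoundedDefault) ?_
    filter_upwards [eventually_forall_rejProb_le_ofReal (K := K) hα0 hα1 hm hK hD hb'] with G hG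
    exact iSup₂_le hG
  · refine le_of_forall_lt_imp_le_of_dense fun b hb => ?_
    have hbt : b ≠ ⊤ := (hb.trans ENNReal.ofReal_lt_top).ne
    have hb' : b.toReal < α := (ENNReal.lt_ofReal_iff_toReal_lt hbt).1 hb
    rw [← ENNReal.ofReal_toReal hbt]
    refine le_limsup_of_frequently_le (Eventually.frequently ?_) (by isBoundedDefault)
    -- For c = 0 the asymptotic lower bound is exactly α.
    filter_upwards [eventually_forall_ofReal_le_rejProb (δ := fun _ => 0) (c := 0) (K := K)
      hα0 hα1 hm hK.le le_rfl (by simpa using hb') (.of_forall fun _ => ⟨le_rfl, hD⟩)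
      (by simp) (htend 0 hD)] with G hG
    exact (hG F hF).trans (le_iSup₂ (f := fun F _ => rejProb F G α) F hF)
  · refine (liminf_le_liminf (v := fun _ => (1 : ℝ≥0∞)) (.of_forall fun G => ?_)).trans_eq
      (by simp)
    exact (iInf₂_le F hF).trans (rejProb_le_one hF G α)
  · refine le_of_forall_lt_imp_le_of_dense fun b hb => ?_
    have hbt : b ≠ ⊤ := (hb.trans ENNReal.one_lt_top).ne
    have hb' : b.toReal < 1 := by
      rw [← ENNReal.ofReal_one] at hb
      exact (ENNReal.lt_ofReal_iff_toReal_lt hbt).1 hb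
    rw [← ENNReal.ofReal_toReal hbt]
    have hr : 0 < 1 - α := by linarith
    -- For fixed `dlow > 0`, G `dlow` eventually exceeds every c, so c may be taken as large as `b`
    -- demands.
    obtain ⟨c, hc, hc0⟩ : ∃ c : ℝ,
        b.toReal < 1 - (1 - α) * Real.exp (-(m * c * α / (1 - α))) ∧ 0 ≤ c := by
      have h1 : Tendsto (fun c : ℝ => m * c * α / (1 - α)) atTop atTop :=
        ((tendsto_id.const_mul_atTop hm).atTop_mul_const hα0).atTop_div_const hr
      have h2 := ((Real.tendsto_exp_neg_atTop_nhds_zero.comp h1).const_mul (1 - α)).const_sub 1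
      exact ((h2.eventually_const_lt (by simpa using hb')).and (eventually_ge_atTop 0)).exists
    refine le_liminf_of_le (by isBoundedDefault) ?_
    filter_upwards [eventually_forall_ofReal_le_rejProb (δ := fun _ => dlow) (K := K)
      hα0 hα1 hm hK.le hc0 hc (.of_forall fun _ => ⟨hlow.le, hbar⟩)
      ((tendsto_natCast_atTop_atTop.atTop_mul_const hlow).eventually_ge_atTop c)
      (htend dlow hbar)] with G hG
    exact le_iInf₂ hG
  · intro δ hδ hlim hL
    -- A real c strictly between 0 and the liminf; the intermediate `q` below then keeps the final
    -- inequality strict.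
    obtain ⟨c, hc0, hc⟩ := EReal.lt_iff_exists_real_btwn.1 hlim
    have hc0' : 0 < c := by exact_mod_cast hc0
    have hr : 0 < 1 - α := by linarith
    have hexp : Real.exp (-(m * c * α / (1 - α))) < 1 :=
      Real.exp_lt_one_iff.2 (neg_neg_of_pos (by positivity))
    obtain ⟨q, hαq, hq⟩ : ∃ q, α < q ∧ q < 1 - (1 - α) * Real.exp (-(m * c * α / (1 - α))) :=
      exists_between (by nlinarith)
    have hev : ∀ᶠ G : ℕ in atTop, c ≤ G * δ G := by
      filter_upwards [eventually_lt_of_lt_liminf hc] with G hG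
      exact (EReal.coe_lt_coe_iff.1 hG).le
    refine ((ENNReal.ofReal_lt_ofReal_iff (hα0.trans hαq)).2 hαq).trans_le ?_
    refine le_liminf_of_le (by isBoundedDefault) ?_
    filter_upwards [eventually_forall_ofReal_le_rejProb (K := K) hα0 hα1 hm hK.le hc0'.le hq
      ((eventually_ge_atTop 1).mono hδ) hev hL] with G hG
    exact le_iInf₂ hG
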